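/- Let $N\ge 1$ and $\alpha\ge 0$, and let functions on $\mathbb R^N$ be real- or complex-valued. A cube is a closed, nondegenerate cube with sides parallel to the coordinate axes; $|Q|$ is its Lebesgue measure. A special cube is a cube of the form $\prod_{i=1}^N[(k_i-1)2^n,(k_i+1)2^n]$ with $n,k_1,\dots,k_N\in\mathbb Z$, i.e. a product of intervals of the same length each of which is a dyadic interval or the shift of a dyadic interval by half its length; $\mathcal D_0$ is the family of all special cubes. For a cube $Q$ and a locally square-integrable function $g$, let $p_Q(g)$ be the unique polynomial of degree at most $[\alpha]$ such that $\int_Q (g(x)-p_Q(g)(x))\,x^\beta\,dx=0$ for all multi-indices $\beta$ with $|\beta|\le[\alpha]$. For a family $\mathcal J$ of cubes put $$M^{\sharp,2}_{\alpha,\mathcal J}g(x)=\sup_{x\in Q,\;Q\in\mathcal J}\frac1{|Q|^{\alpha/N}}\Big(\frac1{|Q|}\int_Q|g(y)-p_Q(g)(y)|^2\,dy\Big)^{1/2},\qquad \|g\|_{\Lambda_{\alpha,\mathcal J}}=\|M^{\sharp,2}_{\alpha,\mathcal J}g\|_{L^\infty}\in[0,\infty],$$ and let $\Lambda_{\alpha,\mathcal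 J}$ be the set of locally square-integrable functions $g$ with $\|g\|_{\Lambda_{\alpha,\mathcal J}}<\infty$. Write $\Lambda_\alpha$ and $\|\cdot\|_{\Lambda_\alpha}$ when $\mathcal J$ is the family of all cubes. Proposition. $\Lambda_\alpha=\Lambda_{\alpha,\mathcal D_0}$, and there are constants $0<c,C<\infty$ depending only on $\alpha$ and $N$ such that $$c\,\|g\|_{\Lambda_{\alpha,\mathcal D_0}}\le\|g\|_{\Lambda_\alpha}\le C\,\|g\|_{\Lambda_{\alpha,\mathcal D_0}}$$ for every locally square-integrable function $g$. -/

import Mathlib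

open MeasureTheory
open scoped ENNReal NNReal

noncomputable section

/-- `g` is locally square-integrable on `ℝ^N` (with its Lebesgue measure `volume`). -/
def LocallySquareIntegrable {𝕜 : Type*} [RCLike 𝕜] {N : ℕ} (g : (Fin N → ℝ) → 𝕜) : Prop :=
  ∀ K : Set (Fin N → ℝ), IsCompact K → MemLp g 2 (volume.restrict K)

/-- The family of all (closed, nondegenerate, axis-parallel) cubes in `ℝ^N`. -/
def allCubes (N : ℕ) : Set (Set (Fin N → ℝ)) :=
  {Q | ∃ (a : Fin N → ℝ) (l : ℝ), 0 < l ∧ Q = Set.Icc a (fun i => a i + l)}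

/-- The family of special cubes: the products `∏ i, [(k i - 1) 2^n, (k i + 1) 2^n]`, with
`n` and all `k i` arbitrary integers. -/
def specialCubes (N : ℕ) : Set (Set (Fin N → ℝ)) :=
  {Q | ∃ (n : ℤ) (k : Fin N → ℤ),
    Q = Set.Icc (fun i => ((k i : ℝ) - 1) * (2 : ℝ) ^ n) (fun i => ((k i : ℝ) + 1) * (2 : ℝ) ^ n)}

/-- The value at a point of `ℝ^N` of a polynomial with coefficients in `𝕜` (`ℝ` or `ℂ`). -/
def polyVal {𝕜 : Type*} [RCLike 𝕜] {N : ℕ} (p : MvPolynomial (Fin N) 𝕜) (x : Fin N → ℝ) : 𝕜 :=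
  MvPolynomial.eval (fun i => (x i : 𝕜)) p

/-- The function `h χ_Q` has vanishing moments up to order `d`. -/
def VanishingMoments {𝕜 : Type*} [RCLike 𝕜] {N : ℕ} (d : ℕ) (Q : Set (Fin N → ℝ))
    (h : (Fin N → ℝ) → 𝕜) : Prop :=
  ∀ β : Fin N → ℕ, ∑ i, β i ≤ d → ∫ x in Q, h x * ∏ i, (x i : 𝕜) ^ β i = 0

/-- `p` has degree at most `d` and `(g - p) χ_Q` has vanishing moments up to order `d`. -/
def IsMomentPoly {𝕜 : Type*} [RCLike 𝕜] {N : ℕ} (d : ℕ) (Q : Set (Fin N → ℝ))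
    (g : (Fin N → ℝ) → 𝕜) (p : MvPolynomial (Fin N) 𝕜) : Prop :=
  p.totalDegree ≤ d ∧ VanishingMoments d Q (fun x => g x - polyVal p x)

open Classical in
/-- The polynomial `p_Q(g)` of degree at most `d` for which `(g - p_Q(g)) χ_Q` has vanishing
moments up to order `d`. For a cube `Q` and a locally integrable `g` it exists and is unique;
the default value `0` is never used for them. -/
def momentPoly {𝕜 : Type*} [RCLike 𝕜] {N : ℕ} (d : ℕ) (Q : Set (Fin N → ℝ))
    (g : (Fin N → ℝ) → 𝕜) : MvPolynomial (Fin N) 𝕜 :=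
  if h : ∃ p, IsMomentPoly d Q g p then h.choose else 0

/-- The quantity
`|Q|^(-α/N) * ((1/|Q|) ∫_Q |g - p_Q(g)|²)^(1/2)`, where `p_Q(g)` has degree at most `[α]`. -/
def cubeOscillation {𝕜 : Type*} [RCLike 𝕜] {N : ℕ} (α : ℝ) (g : (Fin N → ℝ) → 𝕜)
    (Q : Set (Fin N → ℝ)) : ℝ≥0∞ :=
  (volume Q ^ (α / N))⁻¹ *
    ((volume Q)⁻¹ * ∫⁻ y in Q, ‖g y - polyVal (momentPoly ⌊α⌋₊ Q g) y‖ₑ ^ 2) ^ (1 / 2 : ℝ)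

/-- The sharp maximal function: the supremum of the oscillations of `g` over the cubes of the
family `J` that contain `x`. -/
def sharpMaximal {𝕜 : Type*} [RCLike 𝕜] {N : ℕ} (α : ℝ) (J : Set (Set (Fin N → ℝ)))
    (g : (Fin N → ℝ) → 𝕜) (x : Fin N → ℝ) : ℝ≥0∞ :=
  ⨆ Q ∈ J, ⨆ _ : x ∈ Q, cubeOscillation α g Q

/-- The Lipschitz norm: the `L^∞` norm (essential supremum) of the sharp maximal function,
with value `∞` when the latter is not essentially bounded. -/
def lipNorm {𝕜 : Type*} [RCLike 𝕜] {N : ℕ} (α : ℝ) (J : Set (Set (Fin N → ℝ)))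
    (g : (Fin N → ℝ) → 𝕜) : ℝ≥0∞ :=
  eLpNorm (sharpMaximal α J g) ∞ volume

/-- The Lipschitz class of the family `J`: the locally square-integrable functions whose sharp
maximal function is essentially bounded. -/
def lipSpace (𝕜 : Type*) [RCLike 𝕜] {N : ℕ} (α : ℝ) (J : Set (Set (Fin N → ℝ))) :
    Set ((Fin N → ℝ) → 𝕜) :=
  {g | LocallySquareIntegrable g ∧ lipNorm α J g < ∞}

end

/-! Special cubes are cubes, so one inequality holds with constant 1. For the other, every cube `Q`
lies in a special cube `R` with `|R| ≤ 4^N |Q|`. Since `p_Q(g)` is the best approximation to `g` in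
`L²(Q)` by polynomials of degree at most `[α]`, `∫_Q |g - p_Q(g)|² ≤ ∫_Q |g - p_R(g)|² ≤ ∫_R |g -
p_R(g)|²`. Renormalising from `|R|` to `|Q|` costs `(4^N)^(α/N) (4^N)^(1/2) = 4^α 2^N`. Points of
`Q` lie in `R`, so the maximal functions compare pointwise. -/

section Polynomials

variable {𝕜 : Type*} [RCLike 𝕜] {N : ℕ}

theorem continuous_polyVal (p : MvPolynomial (Fin N) 𝕜) :
    Continuous (polyVal p) := by
  have h : Continuous fun x : Fin N → ℝ => fun i => ((x i : ℝ) : 𝕜) :=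
    continuous_pi fun i => RCLike.continuous_ofReal.comp (continuous_apply i)
  exact (MvPolynomial.continuous_eval p).comp h

theorem memLp_polyVal (p : MvPolynomial (Fin N) 𝕜) {Q : Set (Fin N → ℝ)} (hQ : IsCompact Q) :
    MemLp (polyVal p) 2 (volume.restrict Q) := by
  have : IsFiniteMeasure (volume.restrict Q) :=
    isFiniteMeasure_restrict.mpr hQ.measure_lt_top.ne
  obtain ⟨C, hC⟩ := hQ.exists_bound_of_continuousOn (continuous_polyVal p).continuousOn
  exact MemLp.of_bound (continuous_polyVal p).aestronglyMeasurable C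
    ((ae_restrict_iff' hQ.measurableSet).mpr (ae_of_all _ hC))

theorem polyVal_monomial_one (β : Fin N →₀ ℕ) (x : Fin N → ℝ) :
    polyVal (MvPolynomial.monomial β (1 : 𝕜)) x = ∏ i, (x i : 𝕜) ^ β i := by
  rw [polyVal, MvPolynomial.eval_monomial, one_mul, Finsupp.prod_fintype _ _ (by simp)]

/-- Coordinates are real, so conjugation touches only the coefficients; moments against unconjugated
monomials therefore control the inner products of `L²`. -/
theorem star_polyVal (q : MvPolynomial (Fin N) 𝕜) (x : Fin N → ℝ) :
    starRingEnd 𝕜 (polyVal q x) =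
      ∑ β ∈ q.support, starRingEnd 𝕜 (q.coeff β) * ∏ i, (x i : 𝕜) ^ β i := by
  simp [polyVal, MvPolynomial.eval_eq', map_sum, map_prod]

/-- Vanishing moments up to order `d` amount to orthogonality to the polynomials of degree at
most `d`. -/
theorem VanishingMoments.integral_mul_star_polyVal {d : ℕ} {Q : Set (Fin N → ℝ)}
    {h : (Fin N → ℝ) → 𝕜} (hv : VanishingMoments d Q h) (hQ : IsCompact Q)
    (hh : MemLp h 2 (volume.restrict Q)) {q : MvPolynomial (Fin N) 𝕜} (hq : q.totalDegree ≤ d) :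
    ∫ x in Q, h x * starRingEnd 𝕜 (polyVal q x) = 0 := by
  have key : ∀ x, h x * starRingEnd 𝕜 (polyVal q x) =
      ∑ β ∈ q.support, starRingEnd 𝕜 (q.coeff β) * (h x * ∏ i, (x i : 𝕜) ^ β i) := by
    intro x
    rw [star_polyVal, Finset.mul_sum]
    exact Finset.sum_congr rfl fun β _ => by ring
  simp_rw [key]
  rw [integral_finsetSum]
  · refine Finset.sum_eq_zero fun β hβ => ?_
    rw [integral_const_mul, hv β, mul_zero]
    have := MvPolynomial.le_totalDegree hβ
    rw [Finsupp.sum_fintype _ _ (by simp)] at this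
    exact this.trans hq
  · intro β _
    refine Integrable.const_mul ?_ _
    have := hh.integrable_mul (memLp_polyVal (MvPolynomial.monomial β (1 : 𝕜)) hQ)
    refine this.congr (ae_of_all _ fun x => ?_)
    simp [polyVal_monomial_one]

theorem inner_toLp {μ : Measure (Fin N → ℝ)} {f h : (Fin N → ℝ) → 𝕜} (hf : MemLp f 2 μ)
    (hh : MemLp h 2 μ) :
    inner 𝕜 (hf.toLp f) (hh.toLp h) = ∫ x, h x * starRingEnd 𝕜 (f x) ∂μ := by
  rw [L2.inner_def]
  refine integral_congr_ae ?_
  filter_upwards [hf.coeFn_toLp, hh.coeFn_toLp] with x h1 h2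
  rw [h1, h2, RCLike.inner_apply]

/-- Pythagoras for `g - q = (p - q) + (g - p)`, whose summands are orthogonal in `L²(Q)`. -/
theorem IsMomentPoly.eLpNorm_sub_le {d : ℕ} {Q : Set (Fin N → ℝ)} {g : (Fin N → ℝ) → 𝕜}
    {p q : MvPolynomial (Fin N) 𝕜} (hp : IsMomentPoly d Q g p) (hQ : IsCompact Q)
    (hg : MemLp g 2 (volume.restrict Q)) (hq : q.totalDegree ≤ d) :
    eLpNorm (fun x => g x - polyVal p x) 2 (volume.restrict Q) ≤
      eLpNorm (fun x => g x - polyVal q x) 2 (volume.restrict Q) := by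
  have hu : MemLp (fun x => g x - polyVal p x) 2 (volume.restrict Q) :=
    hg.sub (memLp_polyVal p hQ)
  have hw : MemLp (polyVal (p - q)) 2 (volume.restrict Q) := memLp_polyVal _ hQ
  have horth : inner 𝕜 (hw.toLp _) (hu.toLp _) = 0 := by
    rw [inner_toLp]
    exact hp.2.integral_mul_star_polyVal hQ hu
      ((MvPolynomial.totalDegree_sub _ _).trans (max_le hp.1 hq))
  have hsum : (fun x => g x - polyVal q x) =
      polyVal (p - q) + fun x => g x - polyVal p x := by
    ext x
    simp [polyVal]
  have hpyth := norm_add_sq_eq_norm_sq_add_norm_sq_of_inner_eq_zero _ _ horth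
  have hnorm : ‖hu.toLp _‖ ≤ ‖(hw.add hu).toLp _‖ := by
    rw [MemLp.toLp_add hw hu]
    refine nonneg_le_nonneg_of_sq_le_sq (norm_nonneg _) ?_
    rw [hpyth]
    exact le_add_of_nonneg_left (mul_self_nonneg _)
  rw [Lp.norm_toLp, Lp.norm_toLp,
    ENNReal.toReal_le_toReal hu.eLpNorm_ne_top (hw.add hu).eLpNorm_ne_top] at hnorm
  rwa [hsum]

/-- Orthogonal projection in `L²(Q)` onto the finite-dimensional image of the polynomials of degree
at most `d`. -/
theorem exists_isMomentPoly (d : ℕ) {Q : Set (Fin N → ℝ)} (hQ : IsCompact Q)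
    {g : (Fin N → ℝ) → 𝕜} (hg : MemLp g 2 (volume.restrict Q)) :
    ∃ p, IsMomentPoly d Q g p := by
  let T : MvPolynomial.restrictTotalDegree (Fin N) 𝕜 d →ₗ[𝕜] Lp 𝕜 2 (volume.restrict Q) :=
    { toFun := fun p => (memLp_polyVal p.1 hQ).toLp _
      map_add' := fun p q => by
        rw [← MemLp.toLp_add]
        exact MemLp.toLp_congr _ _ (ae_of_all _ fun x => by simp [polyVal])
      map_smul' := fun c p => by
        rw [RingHom.id_apply, ← MemLp.toLp_const_smul]
        exact MemLp.toLp_congr _ _ (ae_of_all _ fun x => by simp [polyVal]) }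
  obtain ⟨p, hp⟩ : T.range.starProjection (hg.toLp g) ∈ T.range :=
    Submodule.starProjection_apply_mem _ _
  refine ⟨p.1, (MvPolynomial.mem_restrictTotalDegree _ _ _).mp p.2, fun β hβ => ?_⟩
  let b : Fin N →₀ ℕ := Finsupp.equivFunOnFinite.symm β
  let m : MvPolynomial.restrictTotalDegree (Fin N) 𝕜 d :=
    ⟨MvPolynomial.monomial b 1, (MvPolynomial.mem_restrictTotalDegree _ _ _).mpr <| by
      rw [MvPolynomial.totalDegree_monomial _ one_ne_zero, Finsupp.sum_fintype _ _ (by simp)]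
      exact hβ⟩
  have horth := T.range.starProjection_inner_eq_zero (hg.toLp g) (T m) ⟨m, rfl⟩
  rw [← hp, ← inner_conj_symm, map_eq_zero] at horth
  have hsub : hg.toLp g - T p = (hg.sub (memLp_polyVal p.1 hQ)).toLp _ :=
    (MemLp.toLp_sub hg (memLp_polyVal p.1 hQ)).symm
  have hTm : T m = (memLp_polyVal m.1 hQ).toLp _ := rfl
  rw [hsub, hTm, inner_toLp] at horth
  rw [← horth]
  congr 1 with x
  rw [polyVal_monomial_one]
  simp [b, map_prod]

theorem isMomentPoly_momentPoly (d : ℕ) {Q : Set (Fin N → ℝ)} (hQ : IsCompact Q)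
    {g : (Fin N → ℝ) → 𝕜} (hg : MemLp g 2 (volume.restrict Q)) :
    IsMomentPoly d Q g (momentPoly d Q g) := by
  have h := exists_isMomentPoly d hQ hg
  rw [momentPoly, dif_pos h]
  exact h.choose_spec

theorem lintegral_enorm_sq (μ : Measure (Fin N → ℝ)) (f : (Fin N → ℝ) → 𝕜) :
    ∫⁻ y, ‖f y‖ₑ ^ 2 ∂μ = eLpNorm f 2 μ ^ 2 := by
  have := eLpNorm_nnreal_pow_eq_lintegral (f := f) (μ := μ) (p := 2) two_ne_zero
  simpa using this.symm

theorem cubeOscillation_le_of_subset {α : ℝ} (hα : 0 ≤ α) {g : (Fin N → ℝ) → 𝕜}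
    (hg : LocallySquareIntegrable g) {Q R : Set (Fin N → ℝ)} (hQ : IsCompact Q)
    (hR : IsCompact R) (hQR : Q ⊆ R) {K : ℝ≥0} (hK : K ≠ 0)
    (hvol : volume R ≤ K * volume Q) :
    cubeOscillation α g Q ≤ (K ^ (α / N) * K ^ (1 / 2 : ℝ) : ℝ≥0) * cubeOscillation α g R := by
  have hN : 0 ≤ α / N := by positivity
  have hinv : (volume Q)⁻¹ ≤ K * (volume R)⁻¹ := by
    have h := ENNReal.inv_le_inv.mpr hvol
    rw [ENNReal.mul_inv (.inr hQ.measure_lt_top.ne) (.inl ENNReal.coe_ne_top)] at h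
    calc (volume Q)⁻¹ = K * ((K : ℝ≥0∞)⁻¹ * (volume Q)⁻¹) := by
          rw [← mul_assoc, ENNReal.mul_inv_cancel (by simpa using hK) ENNReal.coe_ne_top, one_mul]
      _ ≤ K * (volume R)⁻¹ := by gcongr
  have hint : ∫⁻ y in Q, ‖g y - polyVal (momentPoly ⌊α⌋₊ Q g) y‖ₑ ^ 2 ≤
      ∫⁻ y in R, ‖g y - polyVal (momentPoly ⌊α⌋₊ R g) y‖ₑ ^ 2 := by
    -- On `Q`, the polynomial of `R` is only a competitor of the optimal one.
    refine le_trans ?_ (lintegral_mono_set hQR)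
    rw [lintegral_enorm_sq, lintegral_enorm_sq]
    gcongr
    exact (isMomentPoly_momentPoly _ hQ (hg Q hQ)).eLpNorm_sub_le hQ (hg Q hQ)
      (isMomentPoly_momentPoly _ hR (hg R hR)).1
  rw [cubeOscillation, cubeOscillation, ← ENNReal.inv_rpow, ← ENNReal.inv_rpow, ENNReal.coe_mul,
    ENNReal.coe_rpow_of_nonneg _ hN, ENNReal.coe_rpow_of_nonneg _ (by norm_num),
    mul_mul_mul_comm, ← ENNReal.mul_rpow_of_nonneg _ _ hN,
    ← ENNReal.mul_rpow_of_nonneg _ _ (by norm_num), ← mul_assoc]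
  gcongr

end Polynomials

section Cubes

variable {N : ℕ}

theorem volume_Icc_cube (a : Fin N → ℝ) (l : ℝ) :
    volume (Set.Icc a fun i => a i + l) = ENNReal.ofReal l ^ N := by
  simp [Real.volume_Icc_pi]

theorem isCompact_of_mem_allCubes {Q : Set (Fin N → ℝ)} (hQ : Q ∈ allCubes N) : IsCompact Q := by
  obtain ⟨a, l, -, rfl⟩ := hQ
  exact isCompact_Icc

theorem specialCubes_subset_allCubes : specialCubes N ⊆ allCubes N := by
  rintro _ ⟨n, k, rfl⟩
  refine ⟨fun i => ((k i : ℝ) - 1) * 2 ^ n, 2 * 2 ^ n, by positivity, ?_⟩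
  congr 1 with i
  ring

/-- Every cube lies in a special cube whose side is less than four times as long. -/
theorem exists_specialCube_superset {Q : Set (Fin N → ℝ)} (hQ : Q ∈ allCubes N) :
    ∃ R ∈ specialCubes N, Q ⊆ R ∧ volume R ≤ ((4 ^ N : ℝ≥0) : ℝ≥0∞) * volume Q := by
  obtain ⟨a, l, hl, rfl⟩ := hQ
  -- `2^m < l ≤ 2^(m+1)`: the half-side `2^(m+1)` of the special cube is at least `l` and less than
  -- `2l`.
  obtain ⟨m, hm, hm'⟩ := exists_mem_Ioc_zpow hl one_lt_two
  have hpos : (0 : ℝ) < 2 ^ (m + 1) := by positivity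
  -- The `+ 1` puts the lower corner at the grid point just below `a`. As `a` lies in the lower half
  -- of each side, a length `l` still fits.
  refine ⟨_, ⟨m + 1, fun i => ⌊a i / 2 ^ (m + 1)⌋ + 1, rfl⟩, ?_, ?_⟩
  · refine Set.Icc_subset_Icc (fun i => ?_) fun i => ?_
    · have := (le_div_iff₀ hpos).mp (Int.floor_le (a i / 2 ^ (m + 1)))
      push_cast
      linarith
    · have := (div_lt_iff₀ hpos).mp (Int.lt_floor_add_one (a i / 2 ^ (m + 1)))
      push_cast
      linarith
  · rw [volume_Icc_cube, Real.volume_Icc_pi]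
    have h4 : ∀ t : ℝ, (t + 1) * (2 : ℝ) ^ (m + 1) - (t - 1) * 2 ^ (m + 1) ≤ 4 * l := by
      intro t
      rw [zpow_add_one₀ two_ne_zero]
      linarith
    calc _ ≤ ∏ _i : Fin N, ENNReal.ofReal (4 * l) :=
          Finset.prod_le_prod' fun i _ => ENNReal.ofReal_le_ofReal (h4 _)
      _ = _ := by
        rw [Finset.prod_const, ENNReal.ofReal_mul (by norm_num), mul_pow]
        simp

end Cubes

section Norms

variable {𝕜 : Type*} [RCLike 𝕜] {N : ℕ}

theorem sharpMaximal_mono {α : ℝ} {I J : Set (Set (Fin N → ℝ))} (hIJ : I ⊆ J)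
    (g : (Fin N → ℝ) → 𝕜) (x : Fin N → ℝ) : sharpMaximal α I g x ≤ sharpMaximal α J g x :=
  biSup_mono hIJ

theorem sharpMaximal_allCubes_le {α : ℝ} (hα : 0 ≤ α) {g : (Fin N → ℝ) → 𝕜}
    (hg : LocallySquareIntegrable g) (x : Fin N → ℝ) :
    sharpMaximal α (allCubes N) g x ≤
      ((4 ^ N) ^ (α / N) * (4 ^ N) ^ (1 / 2 : ℝ) : ℝ≥0) * sharpMaximal α (specialCubes N) g x := by
  refine iSup₂_le fun Q hQ => iSup_le fun hx => ?_
  obtain ⟨R, hR, hQR, hvol⟩ := exists_specialCube_superset hQ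
  refine (cubeOscillation_le_of_subset hα hg (isCompact_of_mem_allCubes hQ)
    (isCompact_of_mem_allCubes (specialCubes_subset_allCubes hR)) hQR (by positivity)
    hvol).trans ?_
  gcongr
  exact le_iSup₂_of_le R hR (le_iSup_of_le (hQR hx) le_rfl)

theorem lipNorm_mono {α : ℝ} {I J : Set (Set (Fin N → ℝ))} (hIJ : I ⊆ J)
    (g : (Fin N → ℝ) → 𝕜) : lipNorm α I g ≤ lipNorm α J g :=
  eLpNorm_mono_enorm fun x => sharpMaximal_mono hIJ g x

theorem lipNorm_allCubes_le {α : ℝ} (hα : 0 ≤ α) {g : (Fin N → ℝ) → 𝕜}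
    (hg : LocallySquareIntegrable g) :
    lipNorm α (allCubes N) g ≤
      ((4 ^ N) ^ (α / N) * (4 ^ N) ^ (1 / 2 : ℝ) : ℝ≥0) * lipNorm α (specialCubes N) g := by
  rw [lipNorm, lipNorm, eLpNorm_exponent_top, eLpNorm_exponent_top, eLpNormEssSup, eLpNormEssSup,
    ← ENNReal.essSup_const_mul]
  exact essSup_mono_ae (ae_of_all _ fun x => sharpMaximal_allCubes_le hα hg x)

end Norms

theorem proposition2p1 {𝕜 : Type*} [RCLike 𝕜] (N : ℕ) (hN : 1 ≤ N) (α : ℝ) (hα : 0 ≤ α) :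
    lipSpace 𝕜 α (allCubes N) = lipSpace 𝕜 α (specialCubes N) ∧
    ∃ c C : ℝ≥0, 0 < c ∧ 0 < C ∧
      ∀ g : (Fin N → ℝ) → 𝕜, LocallySquareIntegrable g →
        c * lipNorm α (specialCubes N) g ≤ lipNorm α (allCubes N) g ∧
        lipNorm α (allCubes N) g ≤ C * lipNorm α (specialCubes N) g := by
  refine ⟨?_, 1, (4 ^ N) ^ (α / N) * (4 ^ N) ^ (1 / 2 : ℝ), one_pos, ?_, fun g hg =>
    ⟨?_, lipNorm_allCubes_le hα hg⟩⟩
  · ext g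
    refine ⟨fun ⟨hg, h⟩ => ⟨hg, (lipNorm_mono specialCubes_subset_allCubes g).trans_lt h⟩,
      fun ⟨hg, h⟩ => ⟨hg, (lipNorm_allCubes_le hα hg).trans_lt ?_⟩⟩
    exact ENNReal.mul_lt_top ENNReal.coe_lt_top h
  · have h : (0 : ℝ≥0) < 4 ^ N := by positivity
    exact mul_pos (NNReal.rpow_pos h) (NNReal.rpow_pos h)
  · rw [ENNReal.coe_one, one_mul]
    exact lipNorm_mono specialCubes_subset_allCubes g
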